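/- **Setting.** Let $L,m,n_r,n_c$ be natural numbers and $n=n_rn_c$; the $n$ columns of a matrix are indexed by the pixels of an $n_r\times n_c$ image. All matrix spaces carry the Frobenius inner product, and products of them the sum inner product. Let $A\in\mathbb R^{L\times m}$, $Y\in\mathbb R^{L\times n}$, $\lambda,\lambda_{TV}\ge 0$ and $\rho\in\{1,2\}$, where $\|X\|_{1,1}=\|X\|_1=\sum_{i,j}|X_{ij}|$ and $\|X\|_{2,1}$ is the sum of the Euclidean norms of the rows of $X$. For $X=[x_1,\dots,x_n]\in\mathbb R^{m\times n}$ let $\mathcal H X=\begin{pmatrix}\mathcal H_hX\\ \mathcal H_vX\end{pmatrix}\in\mathbb R^{2m\times n}$, where the $i$-th columns of $\mathcal H_hX$ and $\mathcal H_vX$ are $x_i-x_{i_h}$ and $x_i-x_{i_v}$, with $i_h$ the right and $i_v$ the lower neighbour of the pixel $i$ under periodic boundary conditions. Consider $$\min_{M,N}\ f(M)+g(N)\quad\text{s.t.}\quad FM+GN=0,$$ where $M=(D_1;D_2;D_3;D_5)\in\mathbb R^{(3m+L)\times n}$, $N=(\widetilde D;D_4)\in\mathbb R^{3m\times n}$ (blocks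 stacked vertically, $D_1\in\mathbb R^{L\times n}$, $D_4\in\mathbb R^{2m\times n}$, the others in $\mathbb R^{m\times n}$), $$f(M)=\tfrac12\|D_1-Y\|_F^2+\lambda\|D_2\|_{\rho,1}+\delta_{\mathbb R_+^{m\times n}}(D_5),\qquad g(N)=\lambda_{TV}\|D_4\|_1,$$ $$FM=(-D_1;\,-D_2;\,-D_3;\,-\mathcal HD_3;\,-D_5),\qquad GN=(A\widetilde D;\,\widetilde D;\,\widetilde D;\,D_4;\,\widetilde D),$$ so that the constraint reads $D_1=A\widetilde D$, $D_2=D_3=D_5=\widetilde D$, $D_4=\mathcal HD_3$. Here $\delta_{\mathbb R_+^{m\times n}}$ is $0$ on entrywise nonnegative matrices and $+\infty$ elsewhere. For $\sigma>0$ the augmented Lagrangian is $$L_\sigma(M,N;\Lambda)=f(M)+g(N)+\tfrac\sigma2\|FM+GN-\sigma^{-1}\Lambda\|^2-\tfrac1{2\sigma}\|\Lambda\|^2 .$$ From an arbitrary $(M^0,N^0,\Lambda^0)$, the primal ADMM with step length $\tau$ generates $u^k=(M^k,N^k,\Lambda^k)$ by $$M^{k+1}=\arg\min_M L_\sigma(M,N^k;\Lambda^k),\quad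 N^{k+1}=\arg\min_N L_\sigma(M^{k+1},N;\Lambda^k),\quad \Lambda^{k+1}=\Lambda^k-\tau\sigma(FM^{k+1}+GN^{k+1}).$$ Let $F^T,G^T$ be the adjoints of $F,G$, and let $\Omega$ be the set of KKT points, i.e. of all $(M,N,\Lambda)$ with $F^T\Lambda\in\partial f(M)$, $G^T\Lambda\in\partial g(N)$, $FM+GN=0$. For $u=(M,N,\Lambda)$ let $$Q(u)=\bigl(M-\mathrm{Prox}_f(M+F^T\Lambda),\ N-\mathrm{Prox}_g(N+G^T\Lambda),\ FM+GN\bigr),\qquad \mathrm{Prox}_p(x)=\arg\min_w\{p(w)+\tfrac12\|w-x\|^2\}.$$ Let $\Sigma_f$ and $\Sigma_g$ be any self-adjoint positive semidefinite operators such that, for all $s,s'\in\mathrm{dom} f$, $v\in\partial f(s)$, $v'\in\partial f(s')$, $$f(s)\ge f(s')+\langle v',s-s'\rangle+\tfrac12\|s-s'\|_{\Sigma_f}^2,\qquad \langle v-v',s-s'\rangle\ge\|s-s'\|_{\Sigma_f}^2,$$ and likewise for $g$ and $\Sigma_g$, where $\|x\|_{S}=\sqrt{\langle x,Sx\rangle}$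 (for example $\Sigma_f=0$, $\Sigma_g=0$). Let $\mathcal B^*(M,N)=FM+GN$, let $\mathcal B$ be its adjoint, let $\mathcal I$ be the identity, and put $$\mathcal M=\mathrm{Diag}\bigl(\Sigma_f,\ \Sigma_g+\sigma G^TG,\ (\tau\sigma)^{-1}\mathcal I\bigr)+s_\tau\,\sigma\,\mathcal B\mathcal B^*,\qquad s_\tau=\frac{5-\tau-3\min\{\tau,\tau^{-1}\}}4,$$ where $\mathcal B\mathcal B^*$ acts on the first two components. Write $\mathrm{dist}_{\mathcal M}(u,\Omega)=\inf_{u'\in\Omega}\|u-u'\|_{\mathcal M}$, and $\mathrm{dist}$ for the Euclidean distance. **Theorem.** Suppose that $\Omega\neq\emptyset$, $\sigma>0$ and $\tau\in\bigl(0,\tfrac{1+\sqrt5}2\bigr)$. Then every sequence $u^k$ generated by the primal ADMM converges to some KKT point $\bar u\in\Omega$. If, moreover, $Q^{-1}$ is calm at the origin for $\bar u$ with some modulus $\eta>0$, i.e. there is $r>0$ such that $\mathrm{dist}(u,\Omega)\le\eta\|Q(u)\|$ for all $u$ with $\|u-\bar u\|\le r$, then there exist an integer $\bar k\ge1$ and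 $\mu\in(0,1)$ such that $$\mathrm{dist}_{\mathcal M}^2(u^{k+1},\Omega)\le\mu\,\mathrm{dist}_{\mathcal M}^2(u^k,\Omega)\qquad\text{for all }k\ge\bar k,$$ and there exists $\varsigma\in[\mu,1)$ such that $$\mathrm{dist}_{\mathcal M}^2(u^{k+1},\Omega)\le\varsigma\,\mathrm{dist}_{\mathcal M}^2(u^k,\Omega)\qquad\text{for all }k\ge1 .$$ -/

import Mathlib

open Filter Topology
open scoped InnerProductSpace

noncomputable section

/-! ### Convex analysis in finite-dimensional real Hilbert spaces -/

/-- The subdifferential of an extended-real-valued function. -/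
def subdiff {X : Type*} [NormedAddCommGroup X] [InnerProductSpace ℝ X]
    (f : X → EReal) (x : X) : Set X :=
  {v | ∀ y, f x + ((⟪v, y - x⟫_ℝ : ℝ) : EReal) ≤ f y}

/-- The proximal mapping: `prox f x` is the minimizer of `w ↦ f w + ‖w - x‖² / 2`
(it exists and is unique when `f` is closed, proper and convex). -/
def prox {X : Type*} [NormedAddCommGroup X] [InnerProductSpace ℝ X]
    (f : X → EReal) (x : X) : X :=
  Classical.epsilon fun p =>
    IsMinOn (fun w => f w + ((1 / 2 * ‖w - x‖ ^ 2 : ℝ) : EReal)) Set.univ p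

open Classical in
/-- The indicator function `δ_C`: `0` on `C` and `+∞` outside. -/
def indicatorFun {X : Type*} (C : Set X) (x : X) : EReal := if x ∈ C then 0 else ⊤

/-- `S` is a self-adjoint positive semidefinite operator which bounds from below the strong
convexity of `f` and the strong monotonicity of `∂f`. -/
structure IsConvexityOperator {X : Type*} [NormedAddCommGroup X] [InnerProductSpace ℝ X]
    (f : X → EReal) (S : X →ₗ[ℝ] X) : Prop where
  isPositive : S.IsPositive
  subgradient_ineq : ∀ s s' v', f s ≠ ⊤ → f s' ≠ ⊤ → v' ∈ subdiff f s' →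
    f s' + ((⟪v', s - s'⟫_ℝ + 1 / 2 * ⟪s - s', S (s - s')⟫_ℝ : ℝ) : EReal) ≤ f s
  monotone_ineq : ∀ s s' v v', f s ≠ ⊤ → f s' ≠ ⊤ → v ∈ subdiff f s → v' ∈ subdiff f s' →
    ⟪s - s', S (s - s')⟫_ℝ ≤ ⟪v - v', s - s'⟫_ℝ

/-- `‖x‖_S = √⟨x, S x⟩` for a self-adjoint positive semidefinite operator `S`. -/
def weightedNorm {U : Type*} [NormedAddCommGroup U] [InnerProductSpace ℝ U]
    (S : U →ₗ[ℝ] U) (x : U) : ℝ :=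
  √⟪x, S x⟫_ℝ

/-- `dist_S(x, C) = inf_{x' ∈ C} ‖x - x'‖_S`, for a nonempty set `C`. -/
def weightedDist {U : Type*} [NormedAddCommGroup U] [InnerProductSpace ℝ U]
    (S : U →ₗ[ℝ] U) (x : U) (C : Set U) : ℝ :=
  ⨅ x' : C, weightedNorm S (x - x')

/-- The block diagonal operator `Diag(S, T)` on the Hilbert product. -/
def blockDiag {X Y : Type*} [NormedAddCommGroup X] [InnerProductSpace ℝ X]
    [NormedAddCommGroup Y] [InnerProductSpace ℝ Y] (S : X →ₗ[ℝ] X) (T : Y →ₗ[ℝ] Y) :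
    WithLp 2 (X × Y) →ₗ[ℝ] WithLp 2 (X × Y) :=
  (WithLp.linearEquiv 2 ℝ (X × Y)).symm.toLinearMap ∘ₗ
    (S.prodMap T) ∘ₗ (WithLp.linearEquiv 2 ℝ (X × Y)).toLinearMap

/-! ### Two-block problems `min f(M) + g(N)  s.t.  F M + G N = 0` -/

/-- The data of a two-block problem. -/
structure TwoBlock (X Y Z : Type*) [NormedAddCommGroup X] [InnerProductSpace ℝ X]
    [NormedAddCommGroup Y] [InnerProductSpace ℝ Y]
    [NormedAddCommGroup Z] [InnerProductSpace ℝ Z] where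
  f : X → EReal
  g : Y → EReal
  F : X →ₗ[ℝ] Z
  G : Y →ₗ[ℝ] Z

/-- The space of triples `u = (M, N, Λ)` with its Euclidean (Hilbert product) norm. -/
abbrev Triple (X Y Z : Type*) : Type _ := WithLp 2 (WithLp 2 (X × Y) × Z)

/-- The triple `(M, N, Λ)`. -/
def triple {X Y Z : Type*} (M : X) (N : Y) (Λ : Z) : Triple X Y Z :=
  WithLp.toLp 2 (WithLp.toLp 2 (M, N), Λ)

namespace TwoBlock

variable {X Y Z : Type*} [NormedAddCommGroup X] [InnerProductSpace ℝ X] [FiniteDimensional ℝ X]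
  [NormedAddCommGroup Y] [InnerProductSpace ℝ Y] [FiniteDimensional ℝ Y]
  [NormedAddCommGroup Z] [InnerProductSpace ℝ Z] [FiniteDimensional ℝ Z]

/-- The augmented Lagrangian `L_σ(M, N; Λ)`. -/
def augLagrangian (P : TwoBlock X Y Z) (σ : ℝ) (M : X) (N : Y) (Λ : Z) : EReal :=
  P.f M + P.g N +
    ((σ / 2 * ‖P.F M + P.G N - σ⁻¹ • Λ‖ ^ 2 - 1 / (2 * σ) * ‖Λ‖ ^ 2 : ℝ) : EReal)

/-- `(M k, N k, Λ k)` is a sequence generated by the ADMM with penalty parameter `σ` and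
dual step length `τ`, from an arbitrary initial point. -/
structure IsADMMSeq (P : TwoBlock X Y Z) (σ τ : ℝ) (M : ℕ → X) (N : ℕ → Y) (Λ : ℕ → Z) :
    Prop where
  step_M : ∀ k, IsMinOn (fun x => P.augLagrangian σ x (N k) (Λ k)) Set.univ (M (k + 1))
  step_N : ∀ k, IsMinOn (fun y => P.augLagrangian σ (M (k + 1)) y (Λ k)) Set.univ (N (k + 1))
  step_Λ : ∀ k, Λ (k + 1) = Λ k - (τ * σ) • (P.F (M (k + 1)) + P.G (N (k + 1)))

/-- The solution set `Ω` of the KKT system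
`0 ∈ ∂f(M) - Fᵀ Λ`, `0 ∈ ∂g(N) - Gᵀ Λ`, `F M + G N = 0`. -/
def kktSet (P : TwoBlock X Y Z) : Set (Triple X Y Z) :=
  {u | P.F.adjoint u.snd ∈ subdiff P.f u.fst.fst ∧
    P.G.adjoint u.snd ∈ subdiff P.g u.fst.snd ∧
    P.F u.fst.fst + P.G u.fst.snd = 0}

/-- The KKT mapping `Q`. -/
def kktMap (P : TwoBlock X Y Z) (u : Triple X Y Z) : Triple X Y Z :=
  triple (u.fst.fst - prox P.f (u.fst.fst + P.F.adjoint u.snd))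
    (u.fst.snd - prox P.g (u.fst.snd + P.G.adjoint u.snd))
    (P.F u.fst.fst + P.G u.fst.snd)

/-- `Q⁻¹` is calm at the origin for `ubar` with modulus `η`. -/
def CalmAtOrigin (P : TwoBlock X Y Z) (η : ℝ) (ubar : Triple X Y Z) : Prop :=
  ∃ r > 0, ∀ u, ‖u - ubar‖ ≤ r → Metric.infDist u P.kktSet ≤ η * ‖P.kktMap u‖

/-- The operator `𝓑* (M, N) = F M + G N`. -/
def opBstar (P : TwoBlock X Y Z) : WithLp 2 (X × Y) →ₗ[ℝ] Z :=
  (P.F.coprod P.G) ∘ₗ (WithLp.linearEquiv 2 ℝ (X × Y)).toLinearMap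

/-- The operator
`𝓜 = Diag(Σf, Σg + σ Gᵀ G, (τ σ)⁻¹ I) + ((5 - τ - 3 min(τ, τ⁻¹)) / 4) σ 𝓑 𝓑*`,
the last summand acting on the first two components. -/
def opM (P : TwoBlock X Y Z) (σ τ : ℝ) (Sf : X →ₗ[ℝ] X) (Sg : Y →ₗ[ℝ] Y) :
    Triple X Y Z →ₗ[ℝ] Triple X Y Z :=
  blockDiag
    (blockDiag Sf (Sg + σ • (P.G.adjoint ∘ₗ P.G)) +
      ((5 - τ - 3 * min τ τ⁻¹) / 4 * σ) • (P.opBstar.adjoint ∘ₗ P.opBstar))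
    ((τ * σ)⁻¹ • LinearMap.id)

end TwoBlock

/-! ### The sparse unmixing problem -/

/-- Real matrices with rows indexed by `ι` and columns by `κ`, with the Frobenius inner product
and norm. -/
abbrev FMat (ι κ : Type*) : Type _ := EuclideanSpace ℝ (ι × κ)

/-- Extract the rows `e i` of a matrix. -/
def takeRows {ι ι' κ : Type*} (e : ι' → ι) : FMat ι κ →ₗ[ℝ] FMat ι' κ where
  toFun X := WithLp.toLp 2 fun p => X (e p.1, p.2)
  map_add' _ _ := rfl
  map_smul' _ _ := rfl

/-- Permute the columns of a matrix. -/
def takeCols {ι κ : Type*} (e : κ → κ) : FMat ι κ →ₗ[ℝ] FMat ι κ where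
  toFun X := WithLp.toLp 2 fun p => X (p.1, e p.2)
  map_add' _ _ := rfl
  map_smul' _ _ := rfl

/-- Multiplication on the left by a matrix `A`. -/
def leftMul {ι ι' κ : Type*} [Fintype ι] (A : Matrix ι' ι ℝ) : FMat ι κ →ₗ[ℝ] FMat ι' κ where
  toFun X := WithLp.toLp 2 fun p => ∑ k, A p.1 k * X (k, p.2)
  map_add' X X' := by
    ext p
    simp [mul_add, Finset.sum_add_distrib]
  map_smul' c X := by
    ext p
    simp [Finset.mul_sum, mul_left_comm]

/-- Stack two matrix-valued linear maps vertically. -/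
def stack {E ι ι' κ : Type*} [AddCommGroup E] [Module ℝ E]
    (S : E →ₗ[ℝ] FMat ι κ) (T : E →ₗ[ℝ] FMat ι' κ) : E →ₗ[ℝ] FMat (ι ⊕ ι') κ where
  toFun x := WithLp.toLp 2 fun p =>
    Sum.elim (fun i => S x (i, p.2)) (fun i => T x (i, p.2)) p.1
  map_add' x y := by
    ext ⟨i | i, j⟩ <;> simp
  map_smul' c x := by
    ext ⟨i | i, j⟩ <;> simp

/-- The `ℓ_{1,1}` norm. -/
def norm11 {ι κ : Type*} [Fintype ι] [Fintype κ] (X : FMat ι κ) : ℝ :=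
  ∑ i, ∑ j, |X (i, j)|

/-- The `ℓ_{2,1}` norm: the sum of the Euclidean norms of the rows. -/
def norm21 {ι κ : Type*} [Fintype ι] [Fintype κ] (X : FMat ι κ) : ℝ :=
  ∑ i, √(∑ j, X (i, j) ^ 2)

/-- The `ℓ_{ρ,1}` norm for `ρ = 1` or `ρ = 2`. -/
def normRho {ι κ : Type*} [Fintype ι] [Fintype κ] (ρ : ℕ) (X : FMat ι κ) : ℝ :=
  if ρ = 1 then norm11 X else norm21 X

/-- The `n = nr * nc` pixels of an image with `nr` rows and `nc` columns of pixels; they index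
the columns of the data matrices. -/
abbrev Pixel (nr nc : ℕ) : Type := Fin nr × Fin nc

/-- `x_i - x_{i_h}` in every pixel `i`, with `i_h` the right neighbour (periodic boundary). -/
def diffH (m nr nc : ℕ) : FMat (Fin m) (Pixel nr nc) →ₗ[ℝ] FMat (Fin m) (Pixel nr nc) :=
  LinearMap.id - takeCols fun q => (q.1, finRotate nc q.2)

/-- `x_i - x_{i_v}` in every pixel `i`, with `i_v` the lower neighbour (periodic boundary). -/
def diffV (m nr nc : ℕ) : FMat (Fin m) (Pixel nr nc) →ₗ[ℝ] FMat (Fin m) (Pixel nr nc) :=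
  LinearMap.id - takeCols fun q => (finRotate nr q.1, q.2)

/-- The operator `𝓗 X = [𝓗_h X; 𝓗_v X]`. -/
def diffOp (m nr nc : ℕ) :
    FMat (Fin m) (Pixel nr nc) →ₗ[ℝ] FMat (Fin m ⊕ Fin m) (Pixel nr nc) :=
  stack (diffH m nr nc) (diffV m nr nc)

/-- Matrices `M = (D₁; D₂; D₃; D₅)`. -/
abbrev SpaceM (L m nr nc : ℕ) : Type :=
  FMat (Fin L ⊕ (Fin m ⊕ (Fin m ⊕ Fin m))) (Pixel nr nc)

/-- Matrices `N = (D̃; D₄)`. -/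
abbrev SpaceN (m nr nc : ℕ) : Type :=
  FMat (Fin m ⊕ (Fin m ⊕ Fin m)) (Pixel nr nc)

/-- Multipliers `Λ = (Λ₁; Λ₂; Λ₃; Λ₄; Λ₅)`. -/
abbrev SpaceL (L m nr nc : ℕ) : Type :=
  FMat (Fin L ⊕ (Fin m ⊕ (Fin m ⊕ ((Fin m ⊕ Fin m) ⊕ Fin m)))) (Pixel nr nc)

/-- The component `D₁` of `M`. -/
def blkD1 (L m nr nc : ℕ) : SpaceM L m nr nc →ₗ[ℝ] FMat (Fin L) (Pixel nr nc) :=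
  takeRows Sum.inl

/-- The component `D₂` of `M`. -/
def blkD2 (L m nr nc : ℕ) : SpaceM L m nr nc →ₗ[ℝ] FMat (Fin m) (Pixel nr nc) :=
  takeRows (Sum.inr ∘ Sum.inl)

/-- The component `D₃` of `M`. -/
def blkD3 (L m nr nc : ℕ) : SpaceM L m nr nc →ₗ[ℝ] FMat (Fin m) (Pixel nr nc) :=
  takeRows (Sum.inr ∘ Sum.inr ∘ Sum.inl)

/-- The component `D₅` of `M`. -/
def blkD5 (L m nr nc : ℕ) : SpaceM L m nr nc →ₗ[ℝ] FMat (Fin m) (Pixel nr nc) :=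
  takeRows (Sum.inr ∘ Sum.inr ∘ Sum.inr)

/-- The component `D̃` of `N`. -/
def blkDt (m nr nc : ℕ) : SpaceN m nr nc →ₗ[ℝ] FMat (Fin m) (Pixel nr nc) :=
  takeRows Sum.inl

/-- The component `D₄` of `N`. -/
def blkD4 (m nr nc : ℕ) : SpaceN m nr nc →ₗ[ℝ] FMat (Fin m ⊕ Fin m) (Pixel nr nc) :=
  takeRows Sum.inr

/-- The two-block reformulation of the TV-regularized sparse unmixing model
`min ½‖A X - Y‖² + lam ‖X‖_{ρ,1} + lamTV ‖𝓗 X‖₁  s.t.  X ≥ 0`, with the constraints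
`D₁ = A D̃`, `D₂ = D̃`, `D₃ = D̃`, `D₄ = 𝓗 D₃`, `D₅ = D̃` written as `F M + G N = 0`. -/
def unmixing {L m nr nc : ℕ} (ρ : ℕ) (lam lamTV : ℝ) (A : Matrix (Fin L) (Fin m) ℝ)
    (Y : FMat (Fin L) (Pixel nr nc)) :
    TwoBlock (SpaceM L m nr nc) (SpaceN m nr nc) (SpaceL L m nr nc) where
  f M := ((1 / 2 * ‖blkD1 L m nr nc M - Y‖ ^ 2 + lam * normRho ρ (blkD2 L m nr nc M) : ℝ) : EReal)
    + indicatorFun {X | ∀ p, 0 ≤ X p} (blkD5 L m nr nc M)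
  g N := ((lamTV * norm11 (blkD4 m nr nc N) : ℝ) : EReal)
  F := -stack (blkD1 L m nr nc) (stack (blkD2 L m nr nc) (stack (blkD3 L m nr nc)
    (stack (diffOp m nr nc ∘ₗ blkD3 L m nr nc) (blkD5 L m nr nc))))
  G := stack (leftMul A ∘ₗ blkDt m nr nc) (stack (blkDt m nr nc) (stack (blkDt m nr nc)
    (stack (blkD4 m nr nc) (blkDt m nr nc))))

end

section ConvexAnalysis

variable {X Z : Type*} [NormedAddCommGroup X] [InnerProductSpace ℝ X]
  [NormedAddCommGroup Z] [InnerProductSpace ℝ Z]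

/-- Closed proper convex extended-real-valued functions. -/
structure IsClosedProperConvex (f : X → EReal) : Prop where
  ne_bot : ∀ x, f x ≠ ⊥
  exists_ne_top : ∃ x, f x ≠ ⊤
  lowerSemicontinuous : LowerSemicontinuous f
  convex : Convex ℝ {p : X × ℝ | f p.1 ≤ p.2}

theorem EReal.exists_coe_eq {a : EReal} (h : a ≠ ⊥) (h' : a ≠ ⊤) : ∃ r : ℝ, a = r :=
  ⟨a.toReal, (EReal.coe_toReal h' h).symm⟩

theorem nonpos_of_forall_le_mul {w K : ℝ} (h : ∀ t : ℝ, 0 < t → t ≤ 1 → w ≤ t * K) : w ≤ 0 := by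
  have h1 : Tendsto (fun t : ℝ => t * K) (𝓝[>] 0) (𝓝 0) := by
    have : Tendsto (fun t : ℝ => t * K) (𝓝 0) (𝓝 (0 * K)) := tendsto_id.mul_const K
    rw [zero_mul] at this
    exact this.mono_left nhdsWithin_le_nhds
  refine ge_of_tendsto h1 ?_
  filter_upwards [Ioc_mem_nhdsGT (zero_lt_one' ℝ)] with t ht
  exact h t ht.1 ht.2

namespace IsClosedProperConvex

variable {f : X → EReal}

theorem ne_top_of_mem_subdiff (hf : IsClosedProperConvex f) {x v : X} (hv : v ∈ subdiff f x) :
    f x ≠ ⊤ := by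
  obtain ⟨y, hy⟩ := hf.exists_ne_top
  intro hx
  have h := hv y
  rw [hx, EReal.top_add_coe, top_le_iff] at h
  exact hy h

/-- The subdifferential of a convex function is monotone. -/
theorem inner_sub_nonneg (hf : IsClosedProperConvex f) {x y v w : X} (hv : v ∈ subdiff f x)
    (hw : w ∈ subdiff f y) : 0 ≤ ⟪v - w, x - y⟫_ℝ := by
  obtain ⟨a, ha⟩ := EReal.exists_coe_eq (hf.ne_bot x) (hf.ne_top_of_mem_subdiff hv)
  obtain ⟨b, hb⟩ := EReal.exists_coe_eq (hf.ne_bot y) (hf.ne_top_of_mem_subdiff hw)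
  have h1 := hv y
  have h2 := hw x
  rw [ha, hb] at h1 h2
  have h1' : a + ⟪v, y - x⟫_ℝ ≤ b := by exact_mod_cast h1
  have h2' : b + ⟪w, x - y⟫_ℝ ≤ a := by exact_mod_cast h2
  rw [← neg_sub x y, inner_neg_right] at h1'
  rw [inner_sub_left]
  linarith

theorem isClosed_graph_subdiff (hf : IsClosedProperConvex f) :
    IsClosed {p : X × X | p.2 ∈ subdiff f p.1} := by
  have : {p : X × X | p.2 ∈ subdiff f p.1} =
      ⋂ y, {p : X × X | f p.1 + ((⟪p.2, y - p.1⟫_ℝ : ℝ) : EReal) ≤ f y} := by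
    ext p
    simp [subdiff]
  rw [this]
  refine isClosed_iInter fun y => ?_
  by_cases hy : f y = ⊤
  · simp [hy]
  obtain ⟨b, hb⟩ := EReal.exists_coe_eq (hf.ne_bot y) hy
  have h : {p : X × X | f p.1 + ((⟪p.2, y - p.1⟫_ℝ : ℝ) : EReal) ≤ f y} =
      (fun p : X × X => (p.1, ((b - ⟪p.2, y - p.1⟫_ℝ : ℝ) : EReal))) ⁻¹'
        {p : X × EReal | f p.1 ≤ p.2} := by
    ext p
    simp only [Set.mem_ofPred_eq, Set.mem_preimage, hb]
    by_cases hp : f p.1 = ⊤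
    · rw [hp, EReal.top_add_coe]
      simp only [top_le_iff, EReal.coe_ne_top]
    · obtain ⟨a, ha⟩ := EReal.exists_coe_eq (hf.ne_bot p.1) hp
      rw [ha, ← EReal.coe_add, EReal.coe_le_coe_iff, EReal.coe_le_coe_iff, le_sub_iff_add_le]
  rw [h]
  refine hf.lowerSemicontinuous.isClosed_epigraph.preimage ?_
  refine continuous_fst.prodMk (continuous_coe_real_ereal.comp ?_)
  fun_prop

/-- Fermat's rule for the sum of a convex function and a convex quadratic. -/
theorem mem_subdiff_of_forall_le [FiniteDimensional ℝ X] [FiniteDimensional ℝ Z]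
    (hf : IsClosedProperConvex f) (T : X →ₗ[ℝ] Z) (c : Z) (s : ℝ) {x : X}
    (h : ∀ y, f x + ((s / 2 * ‖T x + c‖ ^ 2 : ℝ) : EReal) ≤
      f y + ((s / 2 * ‖T y + c‖ ^ 2 : ℝ) : EReal)) :
    -(s • T.adjoint (T x + c)) ∈ subdiff f x := by
  obtain ⟨a, ha⟩ : ∃ a : ℝ, f x = a := by
    refine EReal.exists_coe_eq (hf.ne_bot x) fun hx => ?_
    obtain ⟨y, hy⟩ := hf.exists_ne_top
    obtain ⟨b, hb⟩ := EReal.exists_coe_eq (hf.ne_bot y) hy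
    have := h y
    rw [hx, hb, EReal.top_add_coe, top_le_iff, ← EReal.coe_add] at this
    exact EReal.coe_ne_top _ this
  intro y
  by_cases hy : f y = ⊤
  · simp [hy]
  obtain ⟨b, hb⟩ := EReal.exists_coe_eq (hf.ne_bot y) hy
  rw [ha, hb, ← EReal.coe_add, EReal.coe_le_coe_iff, inner_neg_left, real_inner_smul_left,
    LinearMap.adjoint_inner_left]
  suffices a - b - s * ⟪T x + c, T (y - x)⟫_ℝ ≤ 0 by linarith
  refine nonpos_of_forall_le_mul (K := s / 2 * ‖T (y - x)‖ ^ 2) fun t ht0 ht1 => ?_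
  have hz : f ((1 - t) • x + t • y) ≤ (((1 - t) * a + t * b : ℝ) : EReal) := by
    have := hf.convex (x := (x, a)) ha.le (y := (y, b)) hb.le (sub_nonneg.2 ht1) ht0.le
      (sub_add_cancel 1 t)
    simpa using this
  have hq : T ((1 - t) • x + t • y) + c = (T x + c) + t • T (y - x) := by
    simp only [map_add, map_smul, map_sub]
    module
  have h1 := (h ((1 - t) • x + t • y)).trans (add_le_add_left hz _)
  rw [ha, hq, ← EReal.coe_add, ← EReal.coe_add, EReal.coe_le_coe_iff,
    norm_add_sq_real (T x + c), real_inner_smul_right, norm_smul, mul_pow, Real.norm_eq_abs, sq_abs] at h1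
  refine le_of_mul_le_mul_left ?_ ht0
  nlinarith

variable [FiniteDimensional ℝ X]

theorem exists_isMinOn_add_sq (hf : IsClosedProperConvex f) {x₀ v : X} (hv : v ∈ subdiff f x₀)
    (x : X) :
    ∃ p, IsMinOn (fun w => f w + ((1 / 2 * ‖w - x‖ ^ 2 : ℝ) : EReal)) Set.univ p := by
  obtain ⟨a, ha⟩ := EReal.exists_coe_eq (hf.ne_bot x₀) (hf.ne_top_of_mem_subdiff hv)
  set R : ℝ := 2 * (‖x₀ - x‖ + ‖v‖) with hR
  have hlsc : LowerSemicontinuous (fun w => f w + ((1 / 2 * ‖w - x‖ ^ 2 : ℝ) : EReal)) := by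
    refine hf.lowerSemicontinuous.add' ?_ fun w => EReal.continuousAt_add (Or.inr ?_) (Or.inr ?_)
    · exact (continuous_coe_real_ereal.comp (by fun_prop)).lowerSemicontinuous
    · exact EReal.coe_ne_bot _
    · exact EReal.coe_ne_top _
  have hx₀ : x₀ ∈ Metric.closedBall x₀ R := Metric.mem_closedBall_self (by positivity)
  have := FiniteDimensional.proper_real X
  obtain ⟨p, -, hmin⟩ := (hlsc.lowerSemicontinuousOn _).exists_isMinOn ⟨x₀, hx₀⟩
    (isCompact_closedBall x₀ R)
  refine ⟨p, fun w _ => ?_⟩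
  by_cases hw : w ∈ Metric.closedBall x₀ R
  · exact hmin hw
  refine le_trans (show _ ≤ f x₀ + ((1 / 2 * ‖x₀ - x‖ ^ 2 : ℝ) : EReal) from hmin hx₀) ?_
  change _ ≤ f w + _
  by_cases hwt : f w = ⊤
  · rw [hwt, EReal.top_add_coe]
    exact le_top
  obtain ⟨b, hb⟩ := EReal.exists_coe_eq (hf.ne_bot w) hwt
  have h1 := hv w
  rw [ha, hb, ← EReal.coe_add, EReal.coe_le_coe_iff] at h1
  rw [ha, hb, ← EReal.coe_add, ← EReal.coe_add, EReal.coe_le_coe_iff]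
  rw [Metric.mem_closedBall, dist_eq_norm, not_le] at hw
  have h2 : w - x = (w - x₀) + (x₀ - x) := by abel
  have h3 := abs_le.1 (abs_real_inner_le_norm v (w - x₀))
  have h4 := abs_le.1 (abs_real_inner_le_norm (w - x₀) (x₀ - x))
  rw [h2, norm_add_sq_real]
  nlinarith [norm_nonneg (w - x₀)]

theorem sub_prox_mem_subdiff (hf : IsClosedProperConvex f) {x₀ v : X} (hv : v ∈ subdiff f x₀)
    (x : X) : x - prox f x ∈ subdiff f (prox f x) := by
  have h : IsMinOn (fun w => f w + ((1 / 2 * ‖w - x‖ ^ 2 : ℝ) : EReal)) Set.univ (prox f x) :=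
    Classical.epsilon_spec (hf.exists_isMinOn_add_sq hv x)
  have := hf.mem_subdiff_of_forall_le LinearMap.id (-x) 1 (x := prox f x) fun y => by
    simpa [sub_eq_add_neg] using h (Set.mem_univ y)
  simpa [← sub_eq_add_neg] using this

/-- The proximal residual is bounded by the distance to the subdifferential. -/
theorem norm_sub_prox_le (hf : IsClosedProperConvex f) {x v : X} (hv : v ∈ subdiff f x)
    (w : X) : ‖x - prox f (x + w)‖ ≤ ‖w - v‖ := by
  have h := hf.inner_sub_nonneg (hf.sub_prox_mem_subdiff hv (x + w)) hv
  set p := prox f (x + w)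
  have h1 : x + w - p - v = (w - v) - (p - x) := by abel
  rw [h1, inner_sub_left, real_inner_self_eq_norm_sq] at h
  have h2 := real_inner_le_norm (w - v) (p - x)
  rw [norm_sub_rev x p]
  by_contra hlt
  push Not at hlt
  nlinarith [norm_nonneg (w - v)]

end IsClosedProperConvex

/-- The sum of a continuous convex function and the indicator of a closed convex set. -/
theorem isClosedProperConvex_add_indicatorFun {h : X → ℝ} {C : Set X}
    (hc : Continuous h) (hh : ConvexOn ℝ Set.univ h) (hC : IsClosed C) (hC' : Convex ℝ C)
    (hne : C.Nonempty) : IsClosedProperConvex fun x => (h x : EReal) + indicatorFun C x := by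
  classical
  have key : ∀ x (c : EReal), c ≠ ⊤ →
      ((h x : EReal) + indicatorFun C x ≤ c ↔ x ∈ C ∧ (h x : EReal) ≤ c) := by
    intro x c hc
    by_cases hx : x ∈ C <;> simp [indicatorFun, hx, hc]
  refine ⟨fun x => ?_, ?_, ?_, ?_⟩
  · by_cases hx : x ∈ C <;> simp [indicatorFun, hx]
  · obtain ⟨x, hx⟩ := hne
    exact ⟨x, by simp [indicatorFun, hx]⟩
  · rw [lowerSemicontinuous_iff_isClosed_preimage]
    intro c
    by_cases hct : c = ⊤
    · simp [hct]
    · have : (fun x => (h x : EReal) + indicatorFun C x) ⁻¹' Set.Iic c =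
          C ∩ (fun x => (h x : EReal)) ⁻¹' Set.Iic c := by
        ext x
        exact key x c hct
      rw [this]
      exact hC.inter (isClosed_Iic.preimage (continuous_coe_real_ereal.comp hc))
  · have : {p : X × ℝ | (h p.1 : EReal) + indicatorFun C p.1 ≤ p.2} =
        (Prod.fst ⁻¹' C) ∩ {p : X × ℝ | p.1 ∈ Set.univ ∧ h p.1 ≤ p.2} := by
      ext p
      simp only [Set.mem_ofPred_eq, Set.mem_inter_iff, Set.mem_preimage, Set.mem_univ, true_and]
      rw [key _ _ (EReal.coe_ne_top _), EReal.coe_le_coe_iff]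
    rw [this]
    exact (hC'.linear_preimage (LinearMap.fst ℝ X ℝ)).inter hh.convex_epigraph

end ConvexAnalysis

section Descent

variable {Z : Type*} [NormedAddCommGroup Z] [InnerProductSpace ℝ Z]

theorem one_add_sub_sq_pos {τ : ℝ} (hτ0 : 0 < τ) (hτ : τ < (1 + √5) / 2) : 0 < 1 + τ - τ ^ 2 := by
  have h5 : √5 ^ 2 = 5 := Real.sq_sqrt (by norm_num)
  have h1 : (1:ℝ) < √5 := by
    rw [Real.lt_sqrt (by norm_num)]
    norm_num
  nlinarith [hτ0]

theorem min_inv_self_le_one {τ : ℝ} (hτ0 : 0 < τ) : min τ τ⁻¹ ≤ 1 := by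
  rcases le_total τ 1 with h | h
  · exact (min_le_left _ _).trans h
  · exact (min_le_right _ _).trans (inv_le_one_of_one_le₀ h)

theorem one_sub_add_min_inv_pos {τ : ℝ} (hτ0 : 0 < τ) (hτ : τ < (1 + √5) / 2) :
    0 < 1 - τ + min τ τ⁻¹ := by
  have h := one_add_sub_sq_pos hτ0 hτ
  rcases le_total τ τ⁻¹ with h1 | h1
  · rw [min_eq_left h1]
    linarith
  · rw [min_eq_right h1]
    have : 1 - τ + τ⁻¹ = τ⁻¹ * (1 + τ - τ ^ 2) := by
      field_simp
      ring
    rw [this]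
    positivity

/-- The weighted Young inequality behind the admissible range of ADMM step lengths. -/
theorem two_mul_one_sub_mul_inner_le {τ : ℝ} (hτ0 : 0 < τ) (r d : Z) :
    2 * (1 - τ) * ⟪r, d⟫_ℝ ≤
      (1 - min τ τ⁻¹) * ‖r‖ ^ 2 + (1 - min τ (1 + τ - τ ^ 2)) * ‖d‖ ^ 2 := by
  rcases le_total τ 1 with h | h
  · rw [min_eq_left (h.trans (one_le_inv_iff₀.2 ⟨hτ0, h⟩)), min_eq_left (by nlinarith)]
    have h1 := sq_nonneg ‖r - d‖
    rw [norm_sub_sq_real] at h1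
    nlinarith
  · rw [min_eq_right ((inv_le_one_of_one_le₀ h).trans h), min_eq_right (by nlinarith)]
    have h1 : 0 ≤ (τ - 1) * τ⁻¹ * ‖r + τ • d‖ ^ 2 :=
      mul_nonneg (mul_nonneg (sub_nonneg.2 h) (inv_nonneg.2 hτ0.le)) (sq_nonneg _)
    rw [norm_add_sq_real, real_inner_smul_right, norm_smul, mul_pow, Real.norm_eq_abs,
      sq_abs] at h1
    have h2 : (τ - 1) * τ⁻¹ * (‖r‖ ^ 2 + 2 * (τ * ⟪r, d⟫_ℝ) + τ ^ 2 * ‖d‖ ^ 2) =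
        (1 - τ⁻¹) * ‖r‖ ^ 2 + (1 - (1 + τ - τ ^ 2)) * ‖d‖ ^ 2 - 2 * (1 - τ) * ⟪r, d⟫_ℝ := by
      field_simp
      ring
    linarith

/-- One step of the ADMM, in terms of the errors `l, y` of the multiplier and of the second block
and of the constraint residual `r`; primes denote the new iterate. -/
theorem admm_step_inequality {σ τ : ℝ} (hσ : 0 < σ) (hτ0 : 0 < τ) (hτ : τ < (1 + √5) / 2)
    {r r' y y' l l' : Z} {p q : ℝ}
    (hp : p ≤ ⟪l' + σ • ((τ - 1) • r' + (y' - y)), r' - y'⟫_ℝ)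
    (hq : q ≤ ⟪l' + σ • ((τ - 1) • r'), y'⟫_ℝ)
    (hd : 0 ≤ ⟪(l' + σ • ((τ - 1) • r')) - (l + σ • ((τ - 1) • r)), y' - y⟫_ℝ)
    (hl : l' = l - (τ * σ) • r') :
    (τ * σ)⁻¹ * ‖l'‖ ^ 2 + σ * ‖y'‖ ^ 2 + (5 - τ - 3 * min τ τ⁻¹) / 4 * σ * ‖r'‖ ^ 2
      + 2 * (p + q) + (3 / 4 * (1 - τ + min τ τ⁻¹) * σ * ‖r'‖ ^ 2
        + min τ (1 + τ - τ ^ 2) * σ * ‖y' - y‖ ^ 2) ≤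
    (τ * σ)⁻¹ * ‖l‖ ^ 2 + σ * ‖y‖ ^ 2 + (5 - τ - 3 * min τ τ⁻¹) / 4 * σ * ‖r‖ ^ 2 := by
  have ht := one_sub_add_min_inv_pos hτ0 hτ
  obtain rfl : l = l' + (τ * σ) • r' := by rw [hl]; abel
  obtain ⟨d, rfl⟩ : ∃ d, y = y' - d := ⟨y' - y, by abel⟩
  have hY := two_mul_one_sub_mul_inner_le hτ0 r d
  have e1 : (τ * σ)⁻¹ * ‖l' + (τ * σ) • r'‖ ^ 2 =
      (τ * σ)⁻¹ * ‖l'‖ ^ 2 + 2 * ⟪l', r'⟫_ℝ + τ * σ * ‖r'‖ ^ 2 := by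
    rw [norm_add_sq_real, real_inner_smul_right, norm_smul, mul_pow, Real.norm_eq_abs, sq_abs]
    field_simp
  have e2 : ‖y' - d‖ ^ 2 = ‖y'‖ ^ 2 - 2 * ⟪d, y'⟫_ℝ + ‖d‖ ^ 2 := by
    rw [norm_sub_sq_real, real_inner_comm]
  have e3 : y' - (y' - d) = d := by abel
  have e4 : (l' + σ • ((τ - 1) • r')) - (l' + (τ * σ) • r' + σ • ((τ - 1) • r)) =
      -(σ • r') + (σ * (1 - τ)) • r := by module
  rw [e3] at hp hd ⊢
  rw [e4, inner_add_left, inner_neg_left, real_inner_smul_left, real_inner_smul_left] at hd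
  simp only [inner_add_left, inner_sub_right, real_inner_smul_left,
    real_inner_self_eq_norm_sq] at hp hq
  rw [e1, e2]
  have hY' := mul_le_mul_of_nonneg_left hY hσ.le
  have hr : 0 ≤ (1 - τ + min τ τ⁻¹) * σ * ‖r‖ ^ 2 := by positivity
  have hc : ⟪d, r'⟫_ℝ = ⟪r', d⟫_ℝ := real_inner_comm _ _
  rw [hc] at hp
  linarith

end Descent

section Weighted

variable {U : Type*} [NormedAddCommGroup U] [InnerProductSpace ℝ U] {S : U →ₗ[ℝ] U}

theorem LinearMap.exists_norm_map_le {V : Type*} [NormedAddCommGroup V] [NormedSpace ℝ V]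
    [FiniteDimensional ℝ U] (T : U →ₗ[ℝ] V) : ∃ K : ℝ, 0 ≤ K ∧ ∀ x, ‖T x‖ ≤ K * ‖x‖ :=
  ⟨‖LinearMap.toContinuousLinearMap T‖, norm_nonneg _,
    (LinearMap.toContinuousLinearMap T).le_opNorm⟩

theorem LinearMap.exists_norm_le_of_injective {V : Type*} [NormedAddCommGroup V]
    [NormedSpace ℝ V] [FiniteDimensional ℝ U] {T : U →ₗ[ℝ] V} (hT : Function.Injective T) :
    ∃ K : ℝ, 0 ≤ K ∧ ∀ x, ‖x‖ ≤ K * ‖T x‖ := by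
  obtain ⟨K, -, hK⟩ := T.exists_antilipschitzWith (LinearMap.ker_eq_bot.2 hT)
  exact ⟨K, K.2, fun x => hK.le_mul_norm (map_zero T) x⟩

theorem weightedNorm_nonneg (S : U →ₗ[ℝ] U) (x : U) : 0 ≤ weightedNorm S x :=
  Real.sqrt_nonneg _

theorem weightedDist_nonneg (S : U →ₗ[ℝ] U) (x : U) (C : Set U) : 0 ≤ weightedDist S x C :=
  Real.iInf_nonneg fun _ => weightedNorm_nonneg _ _

theorem weightedDist_le (S : U →ₗ[ℝ] U) (x : U) {C : Set U} {x' : U} (hx' : x' ∈ C) :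
    weightedDist S x C ≤ weightedNorm S (x - x') :=
  ciInf_le ⟨0, by rintro _ ⟨y, rfl⟩; exact weightedNorm_nonneg _ _⟩ (⟨x', hx'⟩ : C)

/-- A uniform decrease of the weighted distances to the points of a set is inherited by the
weighted distance to the set. -/
theorem weightedDist_sq_add_le {C : Set U} (hC : C.Nonempty) {x y : U} {d : ℝ}
    (h : ∀ x' ∈ C, weightedNorm S (x - x') ^ 2 + d ≤ weightedNorm S (y - x') ^ 2) :
    weightedDist S x C ^ 2 + d ≤ weightedDist S y C ^ 2 := by
  have := hC.to_subtype
  rw [← Real.sqrt_le_left (weightedDist_nonneg S y C)]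
  refine le_ciInf fun x' => Real.sqrt_le_iff.2 ⟨weightedNorm_nonneg _ _, ?_⟩
  refine le_trans ?_ (h x' x'.2)
  gcongr
  · exact weightedDist_nonneg _ _ _
  · exact weightedDist_le S x x'.2

theorem exists_weightedDist_le_mul_infDist [FiniteDimensional ℝ U] (S : U →ₗ[ℝ] U) {C : Set U}
    (hC : C.Nonempty) : ∃ K, 0 ≤ K ∧ ∀ x, weightedDist S x C ≤ K * Metric.infDist x C := by
  obtain ⟨K, hK0, hK⟩ := S.exists_norm_map_le
  refine ⟨√K, Real.sqrt_nonneg _, fun x => ?_⟩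
  have := hC.to_subtype
  rw [Metric.infDist_eq_iInf, Real.mul_iInf_of_nonneg (Real.sqrt_nonneg _)]
  refine le_ciInf fun x' => (weightedDist_le S x x'.2).trans ?_
  rw [weightedNorm, dist_eq_norm]
  refine Real.sqrt_le_iff.2 ⟨by positivity, ?_⟩
  rw [mul_pow, Real.sq_sqrt hK0]
  calc _ ≤ ‖x - x'‖ * ‖S (x - x')‖ := real_inner_le_norm _ _
    _ ≤ ‖x - x'‖ * (K * ‖x - x'‖) := by gcongr; exact hK _
    _ = _ := by ring

end Weighted

theorem EReal.add_coe_le_of_add_coe_sub_le {u v : EReal} {b q q' K : ℝ}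
    (h : u + (b : EReal) + ((q - K : ℝ) : EReal) ≤ v + (b : EReal) + ((q' - K : ℝ) : EReal)) :
    u + (q : EReal) ≤ v + (q' : EReal) := by
  have h1 := add_le_add_left h ((K - b : ℝ) : EReal)
  simp only [add_assoc, ← EReal.coe_add] at h1
  have e1 : ∀ x : ℝ, b + (x - K + (K - b)) = x := fun x => by ring
  rwa [e1, e1] at h1

namespace TwoBlock

variable {X Y Z : Type*} [NormedAddCommGroup X] [InnerProductSpace ℝ X]
  [NormedAddCommGroup Y] [InnerProductSpace ℝ Y] [NormedAddCommGroup Z] [InnerProductSpace ℝ Z]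
  {P : TwoBlock X Y Z} {σ τ : ℝ} {M : ℕ → X} {N : ℕ → Y} {Λ : ℕ → Z}
  {Sf : X →ₗ[ℝ] X} {Sg : Y →ₗ[ℝ] Y}

/-- The constraint residual of a pair of blocks. -/
def residual (P : TwoBlock X Y Z) (x : X) (y : Y) : Z := P.F x + P.G y

theorem IsADMMSeq.multiplier_eq (hseq : P.IsADMMSeq σ τ M N Λ) (k : ℕ) :
    Λ k = Λ (k + 1) + (τ * σ) • P.residual (M (k + 1)) (N (k + 1)) := by
  rw [hseq.step_Λ k, residual, sub_add_cancel]

variable [FiniteDimensional ℝ X] [FiniteDimensional ℝ Y] [FiniteDimensional ℝ Z]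

namespace IsADMMSeq

theorem mem_subdiff_f (hseq : P.IsADMMSeq σ τ M N Λ) (hσ : 0 < σ)
    (hf : IsClosedProperConvex P.f) (hg : IsClosedProperConvex P.g) (hg' : ∀ y, P.g y ≠ ⊤)
    (k : ℕ) :
    P.F.adjoint (Λ (k + 1) + σ • ((τ - 1) • P.residual (M (k + 1)) (N (k + 1)) +
      P.G (N (k + 1) - N k))) ∈ subdiff P.f (M (k + 1)) := by
  obtain ⟨b, hb⟩ := EReal.exists_coe_eq (hg.ne_bot (N k)) (hg' _)
  have h := hf.mem_subdiff_of_forall_le P.F (P.G (N k) - σ⁻¹ • Λ k) σ (x := M (k + 1))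
    fun x => by
      have h1 := hseq.step_M k (Set.mem_univ x)
      simp only [augLagrangian, hb, Set.mem_ofPred_eq] at h1
      simpa only [add_sub_assoc] using EReal.add_coe_le_of_add_coe_sub_le h1
  convert h using 1
  have e : σ • (P.F (M (k + 1)) + (P.G (N k) - σ⁻¹ • Λ k)) =
      σ • (P.F (M (k + 1)) + P.G (N k)) - Λ k := by
    rw [← add_sub_assoc, smul_sub, smul_inv_smul₀ hσ.ne']
  rw [← map_smul, ← map_neg, e, hseq.multiplier_eq k, map_sub, residual]
  congr 1
  module

theorem mem_subdiff_g (hseq : P.IsADMMSeq σ τ M N Λ) (hσ : 0 < σ)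
    (hf : IsClosedProperConvex P.f) (hg : IsClosedProperConvex P.g) (hg' : ∀ y, P.g y ≠ ⊤)
    (k : ℕ) :
    P.G.adjoint (Λ (k + 1) + σ • ((τ - 1) • P.residual (M (k + 1)) (N (k + 1)))) ∈
      subdiff P.g (N (k + 1)) := by
  obtain ⟨a, ha⟩ := EReal.exists_coe_eq (hf.ne_bot (M (k + 1)))
    (hf.ne_top_of_mem_subdiff (hseq.mem_subdiff_f hσ hf hg hg' k))
  have h := hg.mem_subdiff_of_forall_le P.G (P.F (M (k + 1)) - σ⁻¹ • Λ k) σ (x := N (k + 1))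
    fun y => by
      have h1 := hseq.step_N k (Set.mem_univ y)
      simp only [augLagrangian, ha, Set.mem_ofPred_eq] at h1
      rw [add_comm (a : EReal), add_comm (a : EReal)] at h1
      simpa only [add_sub_assoc, add_left_comm, add_comm (P.F _)] using
        EReal.add_coe_le_of_add_coe_sub_le h1
  convert h using 1
  have e : σ • (P.G (N (k + 1)) + (P.F (M (k + 1)) - σ⁻¹ • Λ k)) =
      σ • (P.G (N (k + 1)) + P.F (M (k + 1))) - Λ k := by
    rw [← add_sub_assoc, smul_sub, smul_inv_smul₀ hσ.ne']
  rw [← map_smul, ← map_neg, e, hseq.multiplier_eq k, residual]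
  congr 1
  module

end IsADMMSeq

theorem inner_opM (P : TwoBlock X Y Z) (σ τ : ℝ) (Sf : X →ₗ[ℝ] X) (Sg : Y →ₗ[ℝ] Y)
    (u : Triple X Y Z) :
    ⟪u, P.opM σ τ Sf Sg u⟫_ℝ = ⟪u.fst.fst, Sf u.fst.fst⟫_ℝ + ⟪u.fst.snd, Sg u.fst.snd⟫_ℝ +
      σ * ‖P.G u.fst.snd‖ ^ 2 + (5 - τ - 3 * min τ τ⁻¹) / 4 * σ *
        ‖P.residual u.fst.fst u.fst.snd‖ ^ 2 + (τ * σ)⁻¹ * ‖u.snd‖ ^ 2 := by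
  have h : ∀ v : WithLp 2 (X × Y), ⟪v, P.opBstar.adjoint (P.opBstar v)⟫_ℝ =
      ‖P.residual v.fst v.snd‖ ^ 2 := by
    intro v
    rw [LinearMap.adjoint_inner_right, real_inner_self_eq_norm_sq]
    rfl
  have h' := h u.fst
  have hG : ⟪u.fst.snd, P.G.adjoint (P.G u.fst.snd)⟫_ℝ = ‖P.G u.fst.snd‖ ^ 2 := by
    rw [LinearMap.adjoint_inner_right, real_inner_self_eq_norm_sq]
  have h1 : ⟪u, P.opM σ τ Sf Sg u⟫_ℝ =
      ⟪u.fst, blockDiag Sf (Sg + σ • (P.G.adjoint ∘ₗ P.G)) u.fst⟫_ℝ +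
      ⟪u.fst, ((5 - τ - 3 * min τ τ⁻¹) / 4 * σ) • P.opBstar.adjoint (P.opBstar u.fst)⟫_ℝ +
      ⟪u.snd, (τ * σ)⁻¹ • u.snd⟫_ℝ := by
    rw [← inner_add_right]
    rfl
  have h2 : ⟪u.fst, blockDiag Sf (Sg + σ • (P.G.adjoint ∘ₗ P.G)) u.fst⟫_ℝ =
      ⟪u.fst.fst, Sf u.fst.fst⟫_ℝ +
        ⟪u.fst.snd, Sg u.fst.snd + σ • P.G.adjoint (P.G u.fst.snd)⟫_ℝ := rfl
  rw [h1, h2, inner_add_right, real_inner_smul_right, real_inner_smul_right,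
    real_inner_smul_right, h', hG, real_inner_self_eq_norm_sq]
  ring

theorem inner_opM_coeff_pos {τ : ℝ} (hτ0 : 0 < τ) (hτ : τ < (1 + √5) / 2) :
    0 < (5 - τ - 3 * min τ τ⁻¹) / 4 := by
  have h1 := one_sub_add_min_inv_pos hτ0 hτ
  have h2 := min_inv_self_le_one hτ0
  linarith

theorem inner_opM_nonneg (hσ : 0 < σ) (hτ0 : 0 < τ) (hτ : τ < (1 + √5) / 2)
    (hSf : Sf.IsPositive) (hSg : Sg.IsPositive) (u : Triple X Y Z) :
    0 ≤ ⟪u, P.opM σ τ Sf Sg u⟫_ℝ := by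
  rw [inner_opM]
  have h1 := inner_opM_coeff_pos hτ0 hτ
  have h2 := hSf.inner_nonneg_right u.fst.fst
  have h3 := hSg.inner_nonneg_right u.fst.snd
  positivity

/-- If `F` and `G` are injective, the operator `𝓜` is positive definite. -/
theorem exists_norm_sq_le_inner_opM (hσ : 0 < σ) (hτ0 : 0 < τ) (hτ : τ < (1 + √5) / 2)
    (hSf : Sf.IsPositive) (hSg : Sg.IsPositive) (hF : Function.Injective P.F)
    (hG : Function.Injective P.G) :
    ∃ K, 0 ≤ K ∧ ∀ u, ‖u‖ ^ 2 ≤ K * ⟪u, P.opM σ τ Sf Sg u⟫_ℝ := by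
  obtain ⟨K₁, h₁, hK₁⟩ := LinearMap.exists_norm_le_of_injective hF
  obtain ⟨K₂, h₂, hK₂⟩ := LinearMap.exists_norm_le_of_injective hG
  have hs := inner_opM_coeff_pos hτ0 hτ
  obtain ⟨s, hs_eq⟩ : ∃ s, s = (5 - τ - 3 * min τ τ⁻¹) / 4 := ⟨_, rfl⟩
  rw [← hs_eq] at hs
  refine ⟨(2 * K₁ ^ 2 + K₂ ^ 2) * σ⁻¹ + 2 * K₁ ^ 2 * (s * σ)⁻¹ + τ * σ, by positivity,
    fun u => ?_⟩
  have hE := inner_opM P σ τ Sf Sg u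
  rw [← hs_eq] at hE
  set E := ⟪u, P.opM σ τ Sf Sg u⟫_ℝ
  have p1 := hSf.inner_nonneg_right u.fst.fst
  have p2 := hSg.inner_nonneg_right u.fst.snd
  have q1 : 0 ≤ σ * ‖P.G u.fst.snd‖ ^ 2 := by positivity
  have q2 : 0 ≤ s * σ * ‖P.residual u.fst.fst u.fst.snd‖ ^ 2 := by positivity
  have q3 : 0 ≤ (τ * σ)⁻¹ * ‖u.snd‖ ^ 2 := by positivity
  have b1 : ‖P.G u.fst.snd‖ ^ 2 ≤ σ⁻¹ * E := by
    rw [le_inv_mul_iff₀ hσ]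
    linarith
  have b2 : ‖P.residual u.fst.fst u.fst.snd‖ ^ 2 ≤ (s * σ)⁻¹ * E := by
    rw [le_inv_mul_iff₀ (by positivity)]
    linarith
  have b3 : ‖u.snd‖ ^ 2 ≤ (τ * σ) * E := by
    rw [← inv_mul_le_iff₀ (by positivity)]
    linarith
  have c1 : ‖P.F u.fst.fst‖ ≤ ‖P.residual u.fst.fst u.fst.snd‖ + ‖P.G u.fst.snd‖ := by
    have : P.F u.fst.fst = P.residual u.fst.fst u.fst.snd - P.G u.fst.snd := by
      rw [residual, add_sub_cancel_right]
    rw [this]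
    exact norm_sub_le _ _
  have c2 : ‖P.F u.fst.fst‖ ^ 2 ≤
      2 * ‖P.residual u.fst.fst u.fst.snd‖ ^ 2 + 2 * ‖P.G u.fst.snd‖ ^ 2 :=
    (pow_le_pow_left₀ (norm_nonneg _) c1 2).trans (by
      linarith [add_sq_le (a := ‖P.residual u.fst.fst u.fst.snd‖) (b := ‖P.G u.fst.snd‖)])
  have d1 : ‖u.fst.fst‖ ^ 2 ≤ K₁ ^ 2 * ‖P.F u.fst.fst‖ ^ 2 := by
    rw [← mul_pow]
    exact pow_le_pow_left₀ (norm_nonneg _) (hK₁ _) 2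
  have d2 : ‖u.fst.snd‖ ^ 2 ≤ K₂ ^ 2 * ‖P.G u.fst.snd‖ ^ 2 := by
    rw [← mul_pow]
    exact pow_le_pow_left₀ (norm_nonneg _) (hK₂ _) 2
  rw [WithLp.prod_norm_sq_eq_of_L2, WithLp.prod_norm_sq_eq_of_L2]
  have e1 := mul_le_mul_of_nonneg_left (c2.trans (add_le_add
    (mul_le_mul_of_nonneg_left b2 zero_le_two) (mul_le_mul_of_nonneg_left b1 zero_le_two)))
    (sq_nonneg K₁)
  have e2 := mul_le_mul_of_nonneg_left b1 (sq_nonneg K₂)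
  linarith

theorem weightedNorm_opM_sq (hσ : 0 < σ) (hτ0 : 0 < τ) (hτ : τ < (1 + √5) / 2)
    (hSf : Sf.IsPositive) (hSg : Sg.IsPositive) (u : Triple X Y Z) :
    weightedNorm (P.opM σ τ Sf Sg) u ^ 2 = ⟪u, P.opM σ τ Sf Sg u⟫_ℝ :=
  Real.sq_sqrt (inner_opM_nonneg hσ hτ0 hτ hSf hSg u)

end TwoBlock

theorem exists_linear_rate_of_descent {a δ : ℕ → ℝ} {c C : ℝ} {K : ℕ} (ha : ∀ k, 0 ≤ a k)
    (hδ : ∀ k, 0 ≤ δ k) (hc : 0 < c) (hC : 0 ≤ C)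
    (hdesc : ∀ k ≥ 1, a (k + 1) + c * δ k ≤ a k) (hzero : ∀ k, δ k = 0 → a (k + 1) = 0)
    (hloc : ∀ k ≥ K, a (k + 1) ≤ C * δ k) :
    ∃ kbar ≥ 1, ∃ μ ∈ Set.Ioo (0 : ℝ) 1, (∀ k ≥ kbar, a (k + 1) ≤ μ * a k) ∧
      ∃ ς ∈ Set.Ico μ 1, ∀ k ≥ 1, a (k + 1) ≤ ς * a k := by
  have hμ0 : 0 < (C + 1) / (C + 1 + c) := by positivity
  have hμ1 : (C + 1) / (C + 1 + c) < 1 := by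
    rw [div_lt_one (by positivity)]
    linarith
  have hrate : ∀ k ≥ max 1 K, a (k + 1) ≤ (C + 1) / (C + 1 + c) * a k := by
    intro k hk
    have h1 := hdesc k ((le_max_left _ _).trans hk)
    have h2 := hloc k ((le_max_right _ _).trans hk)
    rw [div_mul_eq_mul_div, le_div_iff₀ (by positivity)]
    nlinarith [hδ k, mul_le_mul_of_nonneg_left h2 hc.le,
      mul_le_mul_of_nonneg_left h1 (by positivity : 0 ≤ C + 1), mul_nonneg hc.le (hδ k)]
  refine ⟨max 1 K, le_max_left _ _, _, ⟨hμ0, hμ1⟩, hrate, ?_⟩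
  generalize (C + 1) / (C + 1 + c) = μ at *
  have hstep : ∀ k ≥ 1, ∃ ς ∈ Set.Ico μ 1, a (k + 1) ≤ ς * a k := by
    intro k hk
    have h1 := hdesc k hk
    rcases (ha k).eq_or_lt with h0 | h0
    · refine ⟨μ, ⟨le_rfl, hμ1⟩, ?_⟩
      rw [← h0] at h1 ⊢
      nlinarith [mul_nonneg hc.le (hδ k)]
    · refine ⟨max μ (a (k + 1) / a k), ⟨le_max_left _ _, max_lt hμ1 ?_⟩, ?_⟩
      · rw [div_lt_one h0]
        rcases (hδ k).eq_or_lt with hd | hd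
        · rwa [hzero k hd.symm]
        · nlinarith [mul_pos hc hd]
      · rw [← div_le_iff₀ h0]
        exact le_max_right _ _
  have hfin : ∀ n, ∃ ς ∈ Set.Ico μ 1, ∀ k ≥ 1, k < n → a (k + 1) ≤ ς * a k := by
    intro n
    induction n with
    | zero => exact ⟨μ, ⟨le_rfl, hμ1⟩, fun k _ hk => absurd hk (Nat.not_lt_zero k)⟩
    | succ n ih =>
      obtain ⟨ς₁, h₁, hs₁⟩ := ih
      rcases Nat.eq_zero_or_pos n with rfl | hn
      · exact ⟨μ, ⟨le_rfl, hμ1⟩, fun k hk hk' => by omega⟩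
      obtain ⟨ς₂, h₂, hs₂⟩ := hstep n hn
      refine ⟨max ς₁ ς₂, ⟨h₁.1.trans (le_max_left _ _), max_lt h₁.2 h₂.2⟩, fun k hk hkn => ?_⟩
      rcases (Nat.lt_succ_iff.1 hkn).lt_or_eq with h | rfl
      · exact (hs₁ k hk h).trans (mul_le_mul_of_nonneg_right (le_max_left _ _) (ha k))
      · exact hs₂.trans (mul_le_mul_of_nonneg_right (le_max_right _ _) (ha k))
  obtain ⟨ς, hς, hs⟩ := hfin (max 1 K)
  refine ⟨ς, hς, fun k hk => ?_⟩
  rcases lt_or_ge k (max 1 K) with h | h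
  · exact hs k hk h
  · exact (hrate k h).trans (mul_le_mul_of_nonneg_right hς.1 (ha k))

namespace TwoBlock

variable {X Y Z : Type*} [NormedAddCommGroup X] [InnerProductSpace ℝ X]
  [NormedAddCommGroup Y] [InnerProductSpace ℝ Y] [NormedAddCommGroup Z] [InnerProductSpace ℝ Z]
  {P : TwoBlock X Y Z} {σ τ : ℝ} {M : ℕ → X} {N : ℕ → Y} {Λ : ℕ → Z}
  {Sf : X →ₗ[ℝ] X} {Sg : Y →ₗ[ℝ] Y}

/-- The quantity controlling the decrease of the Lyapunov function in one ADMM step. -/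
def stepGap (P : TwoBlock X Y Z) (M : ℕ → X) (N : ℕ → Y) (k : ℕ) : ℝ :=
  ‖P.residual (M (k + 1)) (N (k + 1))‖ ^ 2 + ‖P.G (N (k + 1) - N k)‖ ^ 2

theorem stepGap_nonneg (k : ℕ) : 0 ≤ P.stepGap M N k := by
  unfold stepGap
  positivity

theorem residual_sub {x x' : X} {y y' : Y} (h : P.F x' + P.G y' = 0) :
    P.residual (x - x') (y - y') = P.residual x y := by
  simp only [residual, map_sub]
  rw [← sub_zero (P.F x + P.G y), ← h]
  abel

variable [FiniteDimensional ℝ X] [FiniteDimensional ℝ Y] [FiniteDimensional ℝ Z]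

namespace IsADMMSeq

theorem exists_descent (hseq : P.IsADMMSeq σ τ M N Λ) (hσ : 0 < σ) (hτ0 : 0 < τ)
    (hτ : τ < (1 + √5) / 2) (hf : IsClosedProperConvex P.f) (hg : IsClosedProperConvex P.g)
    (hg' : ∀ y, P.g y ≠ ⊤) (hSf : IsConvexityOperator P.f Sf)
    (hSg : IsConvexityOperator P.g Sg) :
    ∃ c > 0, ∀ u ∈ P.kktSet, ∀ k ≥ 1,
      ⟪triple (M (k + 1)) (N (k + 1)) (Λ (k + 1)) - u,
        P.opM σ τ Sf Sg (triple (M (k + 1)) (N (k + 1)) (Λ (k + 1)) - u)⟫_ℝ +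
          c * P.stepGap M N k ≤
      ⟪triple (M k) (N k) (Λ k) - u, P.opM σ τ Sf Sg (triple (M k) (N k) (Λ k) - u)⟫_ℝ := by
  have ht := one_sub_add_min_inv_pos hτ0 hτ
  have hw : 0 < min τ (1 + τ - τ ^ 2) := lt_min hτ0 (one_add_sub_sq_pos hτ0 hτ)
  refine ⟨min (3 / 4 * (1 - τ + min τ τ⁻¹) * σ) (min τ (1 + τ - τ ^ 2) * σ), by positivity,
    fun u hu k hk => ?_⟩
  obtain ⟨j, rfl⟩ : ∃ j, k = j + 1 := ⟨k - 1, by omega⟩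
  obtain ⟨hu1, hu2, hu3⟩ := hu
  have hfm := hseq.mem_subdiff_f hσ hf hg hg' (j + 1)
  have hgm := hseq.mem_subdiff_g hσ hf hg hg' (j + 1)
  have hgm' := hseq.mem_subdiff_g hσ hf hg hg' j
  have hp := hSf.monotone_ineq _ _ _ _ (hf.ne_top_of_mem_subdiff hfm)
    (hf.ne_top_of_mem_subdiff hu1) hfm hu1
  have hq := hSg.monotone_ineq _ _ _ _ (hg' _) (hg' _) hgm hu2
  have hd := hg.inner_sub_nonneg hgm hgm'
  rw [← map_sub, LinearMap.adjoint_inner_left] at hp hq hd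
  have hFx : P.F (M (j + 1 + 1) - u.fst.fst) =
      P.residual (M (j + 1 + 1)) (N (j + 1 + 1)) - P.G (N (j + 1 + 1) - u.fst.snd) := by
    rw [← residual_sub hu3, residual, add_sub_cancel_right]
  have hyy : P.G (N (j + 1 + 1) - u.fst.snd) - P.G (N (j + 1) - u.fst.snd) =
      P.G (N (j + 1 + 1) - N (j + 1)) := by
    rw [← map_sub, sub_sub_sub_cancel_right]
  rw [hFx, add_sub_right_comm, ← hyy] at hp
  rw [add_sub_right_comm] at hq
  rw [← hyy] at hd
  have key := admm_step_inequality hσ hτ0 hτ hp hq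
    (r := P.residual (M (j + 1)) (N (j + 1))) (l := Λ (j + 1) - u.snd)
    (by convert hd using 2; abel) (by rw [hseq.multiplier_eq (j + 1)]; abel)
  rw [hyy] at key
  have p1 := hSf.isPositive.inner_nonneg_right (M (j + 1) - u.fst.fst)
  have p2 := hSg.isPositive.inner_nonneg_right (N (j + 1) - u.fst.snd)
  have p3 := hSf.isPositive.inner_nonneg_right (M (j + 1 + 1) - u.fst.fst)
  have p4 := hSg.isPositive.inner_nonneg_right (N (j + 1 + 1) - u.fst.snd)
  have hE : ∀ i, ⟪triple (M i) (N i) (Λ i) - u,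
      P.opM σ τ Sf Sg (triple (M i) (N i) (Λ i) - u)⟫_ℝ =
      ⟪M i - u.fst.fst, Sf (M i - u.fst.fst)⟫_ℝ + ⟪N i - u.fst.snd, Sg (N i - u.fst.snd)⟫_ℝ +
        σ * ‖P.G (N i - u.fst.snd)‖ ^ 2 + (5 - τ - 3 * min τ τ⁻¹) / 4 * σ *
        ‖P.residual (M i) (N i)‖ ^ 2 + (τ * σ)⁻¹ * ‖Λ i - u.snd‖ ^ 2 := by
    intro i
    rw [inner_opM, ← residual_sub (x := M i) (y := N i) hu3]
    rfl
  rw [hE, hE, stepGap, mul_add]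
  have g1 := mul_le_mul_of_nonneg_right (min_le_left
    (3 / 4 * (1 - τ + min τ τ⁻¹) * σ) (min τ (1 + τ - τ ^ 2) * σ))
    (sq_nonneg ‖P.residual (M (j + 1 + 1)) (N (j + 1 + 1))‖)
  have g2 := mul_le_mul_of_nonneg_right (min_le_right
    (3 / 4 * (1 - τ + min τ τ⁻¹) * σ) (min τ (1 + τ - τ ^ 2) * σ))
    (sq_nonneg ‖P.G (N (j + 1 + 1) - N (j + 1))‖)
  linarith

theorem exists_kktMap_sq_le (hseq : P.IsADMMSeq σ τ M N Λ) (hσ : 0 < σ)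
    (hf : IsClosedProperConvex P.f) (hg : IsClosedProperConvex P.g)
    (hg' : ∀ y, P.g y ≠ ⊤) :
    ∃ C, 0 ≤ C ∧ ∀ k, ‖P.kktMap (triple (M (k + 1)) (N (k + 1)) (Λ (k + 1)))‖ ^ 2 ≤
      C * P.stepGap M N k := by
  obtain ⟨K₁, h₁, hK₁⟩ := P.F.adjoint.exists_norm_map_le
  obtain ⟨K₂, h₂, hK₂⟩ := P.G.adjoint.exists_norm_map_le
  refine ⟨2 * K₁ ^ 2 * σ ^ 2 * ((τ - 1) ^ 2 + 1) + K₂ ^ 2 * σ ^ 2 * (τ - 1) ^ 2 + 1,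
    by positivity, fun k => ?_⟩
  have e1 := hf.norm_sub_prox_le (hseq.mem_subdiff_f hσ hf hg hg' k) (P.F.adjoint (Λ (k + 1)))
  have e2 := hg.norm_sub_prox_le (hseq.mem_subdiff_g hσ hf hg hg' k) (P.G.adjoint (Λ (k + 1)))
  rw [← map_sub, sub_add_cancel_left, map_neg, norm_neg] at e1 e2
  have hQ : ‖P.kktMap (triple (M (k + 1)) (N (k + 1)) (Λ (k + 1)))‖ ^ 2 =
      ‖M (k + 1) - prox P.f (M (k + 1) + P.F.adjoint (Λ (k + 1)))‖ ^ 2 +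
      ‖N (k + 1) - prox P.g (N (k + 1) + P.G.adjoint (Λ (k + 1)))‖ ^ 2 +
      ‖P.residual (M (k + 1)) (N (k + 1))‖ ^ 2 := by
    rw [WithLp.prod_norm_sq_eq_of_L2, WithLp.prod_norm_sq_eq_of_L2]
    rfl
  rw [hQ, stepGap]
  set r := P.residual (M (k + 1)) (N (k + 1))
  set d := P.G (N (k + 1) - N k)
  have f1 : ‖(τ - 1) • r + d‖ ^ 2 ≤ 2 * ((τ - 1) ^ 2 * ‖r‖ ^ 2 + ‖d‖ ^ 2) := by
    refine (pow_le_pow_left₀ (norm_nonneg _) (norm_add_le _ _) 2).trans (add_sq_le.trans ?_)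
    rw [norm_smul, mul_pow, Real.norm_eq_abs, sq_abs]
  have g1 := pow_le_pow_left₀ (norm_nonneg _) (e1.trans (hK₁ _)) 2
  have g2 := pow_le_pow_left₀ (norm_nonneg _) (e2.trans (hK₂ _)) 2
  rw [norm_smul, mul_pow, mul_pow, Real.norm_eq_abs, sq_abs] at g1
  rw [norm_smul, norm_smul, mul_pow, mul_pow, mul_pow, Real.norm_eq_abs, Real.norm_eq_abs,
    sq_abs, sq_abs] at g2
  have g3 : K₁ ^ 2 * (σ ^ 2 * ‖(τ - 1) • r + d‖ ^ 2) ≤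
      K₁ ^ 2 * (σ ^ 2 * (2 * ((τ - 1) ^ 2 * ‖r‖ ^ 2 + ‖d‖ ^ 2))) := by gcongr
  have n1 : 0 ≤ K₁ ^ 2 * σ ^ 2 * ‖r‖ ^ 2 := by positivity
  have n2 : 0 ≤ K₁ ^ 2 * σ ^ 2 * (τ - 1) ^ 2 * ‖d‖ ^ 2 := by positivity
  have n3 : 0 ≤ K₂ ^ 2 * σ ^ 2 * (τ - 1) ^ 2 * ‖d‖ ^ 2 := by positivity
  have n4 : 0 ≤ ‖d‖ ^ 2 := by positivity
  linarith

theorem mem_kktSet_of_stepGap_eq_zero (hseq : P.IsADMMSeq σ τ M N Λ) (hσ : 0 < σ)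
    (hf : IsClosedProperConvex P.f) (hg : IsClosedProperConvex P.g)
    (hg' : ∀ y, P.g y ≠ ⊤) {k : ℕ} (h : P.stepGap M N k = 0) :
    triple (M (k + 1)) (N (k + 1)) (Λ (k + 1)) ∈ P.kktSet := by
  obtain ⟨h1, h2⟩ := (add_eq_zero_iff_of_nonneg (sq_nonneg _) (sq_nonneg _)).1 h
  have hr := norm_eq_zero.1 (pow_eq_zero_iff two_ne_zero |>.1 h1)
  have hd := norm_eq_zero.1 (pow_eq_zero_iff two_ne_zero |>.1 h2)
  have e1 := hseq.mem_subdiff_f hσ hf hg hg' k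
  have e2 := hseq.mem_subdiff_g hσ hf hg hg' k
  rw [hr, hd, smul_zero, add_zero, smul_zero, add_zero] at e1
  rw [hr, smul_zero, smul_zero, add_zero] at e2
  exact ⟨e1, e2, hr⟩

theorem exists_tendsto (hseq : P.IsADMMSeq σ τ M N Λ) (hσ : 0 < σ) (hτ0 : 0 < τ)
    (hτ : τ < (1 + √5) / 2) (hf : IsClosedProperConvex P.f) (hg : IsClosedProperConvex P.g)
    (hg' : ∀ y, P.g y ≠ ⊤) (hSf : IsConvexityOperator P.f Sf)
    (hSg : IsConvexityOperator P.g Sg) (hF : Function.Injective P.F)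
    (hG : Function.Injective P.G) (hΩ : P.kktSet.Nonempty) :
    ∃ ubar ∈ P.kktSet, Tendsto (fun k => triple (M k) (N k) (Λ k)) atTop (𝓝 ubar) := by
  obtain ⟨c, hc, hdesc⟩ := hseq.exists_descent hσ hτ0 hτ hf hg hg' hSf hSg
  obtain ⟨K, hK0, hK⟩ := exists_norm_sq_le_inner_opM (P := P) hσ hτ0 hτ hSf.isPositive
    hSg.isPositive hF hG
  have hEnn := inner_opM_nonneg (P := P) hσ hτ0 hτ hSf.isPositive hSg.isPositive
  set S := P.opM σ τ Sf Sg
  set U : ℕ → Triple X Y Z := fun k => triple (M k) (N k) (Λ k) with hU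
  have hanti : ∀ u ∈ P.kktSet, Antitone fun k => ⟪U (k + 1) - u, S (U (k + 1) - u)⟫_ℝ := by
    intro u hu
    refine antitone_nat_of_succ_le fun k => ?_
    have := hdesc u hu (k + 1) (by omega)
    linarith [mul_nonneg hc.le (stepGap_nonneg (P := P) (M := M) (N := N) (k + 1))]
  have hconv : ∀ u ∈ P.kktSet, ∃ l,
      Tendsto (fun k => ⟪U (k + 1) - u, S (U (k + 1) - u)⟫_ℝ) atTop (𝓝 l) := fun u hu =>
    ⟨_, tendsto_atTop_ciInf (hanti u hu) ⟨0, by rintro _ ⟨k, rfl⟩; exact hEnn _⟩⟩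
  obtain ⟨u, hu⟩ := hΩ
  have hgap : Tendsto (fun k => P.stepGap M N (k + 1)) atTop (𝓝 0) := by
    obtain ⟨l, hl⟩ := hconv u hu
    have h1 := (hl.sub (hl.comp (tendsto_add_atTop_nat 1))).const_mul c⁻¹
    rw [sub_self, mul_zero] at h1
    refine squeeze_zero (fun k => stepGap_nonneg _) (fun k => ?_) h1
    rw [le_inv_mul_iff₀ hc]
    have := hdesc u hu (k + 1) (by omega)
    simp only [Function.comp]
    linarith
  have hgap' := Real.continuous_sqrt.tendsto' 0 0 Real.sqrt_zero |>.comp hgap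
  have hres : Tendsto (fun k => P.residual (M (k + 2)) (N (k + 2))) atTop (𝓝 0) :=
    squeeze_zero_norm (fun k => Real.le_sqrt_of_sq_le (le_add_of_nonneg_right (sq_nonneg _))) hgap'
  have hdiff : Tendsto (fun k => P.G (N (k + 2) - N (k + 1))) atTop (𝓝 0) :=
    squeeze_zero_norm (fun k => Real.le_sqrt_of_sq_le (le_add_of_nonneg_left (sq_nonneg _))) hgap'
  have hmem : ∀ k, U (k + 2) ∈ Metric.closedBall u (√(K * ⟪U 1 - u, S (U 1 - u)⟫_ℝ)) := by
    intro k
    rw [Metric.mem_closedBall, dist_eq_norm]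
    exact Real.le_sqrt_of_sq_le ((hK _).trans
      (mul_le_mul_of_nonneg_left (hanti u hu (Nat.zero_le (k + 1))) hK0))
  have := FiniteDimensional.proper_real (Triple X Y Z)
  obtain ⟨ubar, -, φ, hφ, hlim⟩ := tendsto_subseq_of_bounded Metric.isBounded_closedBall hmem
  have hM : Tendsto (fun j => M (φ j + 2)) atTop (𝓝 ubar.fst.fst) :=
    ((by fun_prop : Continuous fun v : Triple X Y Z => v.fst.fst).tendsto _).comp hlim
  have hN : Tendsto (fun j => N (φ j + 2)) atTop (𝓝 ubar.fst.snd) :=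
    ((by fun_prop : Continuous fun v : Triple X Y Z => v.fst.snd).tendsto _).comp hlim
  have hΛ : Tendsto (fun j => Λ (φ j + 2)) atTop (𝓝 ubar.snd) :=
    ((by fun_prop : Continuous fun v : Triple X Y Z => v.snd).tendsto _).comp hlim
  have hres' := (hres.comp hφ.tendsto_atTop).const_smul (τ - 1)
  have hubar : ubar ∈ P.kktSet := by
    refine ⟨?_, ?_, ?_⟩
    · have h1 := (P.F.adjoint.continuous_of_finiteDimensional.tendsto _).comp
        (hΛ.add ((hres'.add (hdiff.comp hφ.tendsto_atTop)).const_smul σ))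
      rw [smul_zero, add_zero, smul_zero, add_zero] at h1
      exact hf.isClosed_graph_subdiff.mem_of_tendsto (hM.prodMk_nhds h1)
        (Eventually.of_forall fun j => hseq.mem_subdiff_f hσ hf hg hg' (φ j + 1))
    · have h1 := (P.G.adjoint.continuous_of_finiteDimensional.tendsto _).comp
        (hΛ.add (hres'.const_smul σ))
      rw [smul_zero, smul_zero, add_zero] at h1
      exact hg.isClosed_graph_subdiff.mem_of_tendsto (hN.prodMk_nhds h1)
        (Eventually.of_forall fun j => hseq.mem_subdiff_g hσ hf hg hg' (φ j + 1))
    · exact tendsto_nhds_unique (((P.F.continuous_of_finiteDimensional.tendsto _).comp hM).add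
        ((P.G.continuous_of_finiteDimensional.tendsto _).comp hN)) (hres.comp hφ.tendsto_atTop)
  refine ⟨ubar, hubar, ?_⟩
  obtain ⟨l, hl⟩ := hconv ubar hubar
  have hS := S.continuous_of_finiteDimensional
  have h0 : Tendsto (fun j => ⟪U (φ j + 2) - ubar, S (U (φ j + 2) - ubar)⟫_ℝ) atTop (𝓝 0) :=
    ((by fun_prop : Continuous fun v => ⟪v - ubar, S (v - ubar)⟫_ℝ).tendsto' ubar 0
      (by simp)).comp hlim
  obtain rfl : l = 0 := tendsto_nhds_unique
    (hl.comp ((tendsto_add_atTop_nat 1).comp hφ.tendsto_atTop)) h0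
  refine (tendsto_add_atTop_iff_nat 1).1 (tendsto_iff_norm_sub_tendsto_zero.2 ?_)
  have h1 := hl.const_mul K
  rw [mul_zero] at h1
  have h2 := Real.continuous_sqrt.tendsto' 0 0 Real.sqrt_zero |>.comp h1
  exact squeeze_zero (fun _ => norm_nonneg _) (fun k => Real.le_sqrt_of_sq_le (hK _)) h2

/-- Linear convergence of the ADMM under calmness of the inverse KKT mapping. -/
theorem exists_linear_rate (hseq : P.IsADMMSeq σ τ M N Λ) (hσ : 0 < σ) (hτ0 : 0 < τ)
    (hτ : τ < (1 + √5) / 2) (hf : IsClosedProperConvex P.f) (hg : IsClosedProperConvex P.g)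
    (hg' : ∀ y, P.g y ≠ ⊤) (hSf : IsConvexityOperator P.f Sf)
    (hSg : IsConvexityOperator P.g Sg) {ubar : Triple X Y Z} (hubar : ubar ∈ P.kktSet)
    (hlim : Tendsto (fun k => triple (M k) (N k) (Λ k)) atTop (𝓝 ubar))
    {η : ℝ} (hcalm : P.CalmAtOrigin η ubar) :
    ∃ kbar ≥ 1, ∃ μ ∈ Set.Ioo (0 : ℝ) 1,
      (∀ k ≥ kbar,
        weightedDist (P.opM σ τ Sf Sg) (triple (M (k + 1)) (N (k + 1)) (Λ (k + 1)))
            P.kktSet ^ 2 ≤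
          μ * weightedDist (P.opM σ τ Sf Sg) (triple (M k) (N k) (Λ k)) P.kktSet ^ 2) ∧
      ∃ ς ∈ Set.Ico μ 1, ∀ k ≥ 1,
        weightedDist (P.opM σ τ Sf Sg) (triple (M (k + 1)) (N (k + 1)) (Λ (k + 1)))
            P.kktSet ^ 2 ≤
          ς * weightedDist (P.opM σ τ Sf Sg) (triple (M k) (N k) (Λ k)) P.kktSet ^ 2 := by
  obtain ⟨c, hc, hdesc⟩ := hseq.exists_descent hσ hτ0 hτ hf hg hg' hSf hSg
  obtain ⟨C, hC0, hC⟩ := hseq.exists_kktMap_sq_le hσ hf hg hg'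
  obtain ⟨K, hK0, hK⟩ := exists_weightedDist_le_mul_infDist (P.opM σ τ Sf Sg) ⟨ubar, hubar⟩
  obtain ⟨r, hr, hcalm⟩ := hcalm
  obtain ⟨k₀, hk₀⟩ := Metric.tendsto_atTop.1 hlim r hr
  have hsq := weightedNorm_opM_sq (P := P) hσ hτ0 hτ hSf.isPositive hSg.isPositive
  refine exists_linear_rate_of_descent
    (a := fun k => weightedDist (P.opM σ τ Sf Sg) (triple (M k) (N k) (Λ k)) P.kktSet ^ 2)
    (δ := P.stepGap M N) (C := K ^ 2 * (η ^ 2 * C)) (K := k₀)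
    (fun k => sq_nonneg _) (fun k => stepGap_nonneg k) hc (by positivity) (fun k hk => ?_)
    (fun k hk => ?_) fun k hk => ?_
  · refine weightedDist_sq_add_le ⟨ubar, hubar⟩ fun u hu => ?_
    rw [hsq, hsq]
    exact hdesc u hu k hk
  · have h := weightedDist_le (P.opM σ τ Sf Sg) (triple (M (k + 1)) (N (k + 1)) (Λ (k + 1)))
      (hseq.mem_kktSet_of_stepGap_eq_zero hσ hf hg hg' hk)
    rw [sub_self, weightedNorm, inner_zero_left, Real.sqrt_zero] at h
    rw [le_antisymm h (weightedDist_nonneg _ _ _), zero_pow two_ne_zero]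
  · have h1 := hcalm (triple (M (k + 1)) (N (k + 1)) (Λ (k + 1))) (by
      rw [← dist_eq_norm]
      exact (hk₀ (k + 1) (by omega)).le)
    calc _ ≤ (K * (η * ‖P.kktMap (triple (M (k + 1)) (N (k + 1)) (Λ (k + 1)))‖)) ^ 2 :=
          pow_le_pow_left₀ (weightedDist_nonneg _ _ _)
            ((hK _).trans (mul_le_mul_of_nonneg_left h1 hK0)) 2
      _ = K ^ 2 * (η ^ 2 * ‖P.kktMap (triple (M (k + 1)) (N (k + 1)) (Λ (k + 1)))‖ ^ 2) := by
          ring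
      _ ≤ K ^ 2 * (η ^ 2 * (C * P.stepGap M N k)) := by
          gcongr
          exact hC k
      _ = _ := by ring

end IsADMMSeq
end TwoBlock

section Matrices

variable {ι κ : Type*} [Fintype ι] [Fintype κ]

theorem convexOn_norm_comp {E V : Type*} [AddCommGroup E] [Module ℝ E]
    [NormedAddCommGroup V] [NormedSpace ℝ V] (T : E →ₗ[ℝ] V) :
    ConvexOn ℝ Set.univ fun x => ‖T x‖ :=
  convexOn_univ_norm.comp_linearMap T

theorem convexOn_finset_sum {E α : Type*} [AddCommGroup E] [Module ℝ E] (s : Finset α)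
    {h : α → E → ℝ} (hh : ∀ i, ConvexOn ℝ Set.univ (h i)) :
    ConvexOn ℝ Set.univ fun x => ∑ i ∈ s, h i x := by
  classical
  induction s using Finset.induction_on with
  | empty => simpa using convexOn_const (0 : ℝ) convex_univ
  | insert a s ha ih =>
    simp only [Finset.sum_insert ha]
    exact (hh a).add ih

theorem convexOn_norm11 : ConvexOn ℝ Set.univ (norm11 : FMat ι κ → ℝ) := by
  refine convexOn_finset_sum _ fun i => convexOn_finset_sum _ fun j => ?_
  exact convexOn_norm_comp (EuclideanSpace.proj (𝕜 := ℝ) (i, j) : FMat ι κ →L[ℝ] ℝ).toLinearMap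

theorem norm21_eq (X : FMat ι κ) :
    norm21 X = ∑ i, ‖takeRows (fun _ : Unit => i) X‖ := by
  simp only [norm21, EuclideanSpace.norm_eq, Fintype.sum_prod_type, Real.norm_eq_abs, sq_abs,
    Finset.univ_unique, Finset.sum_singleton]
  rfl

theorem convexOn_norm21 : ConvexOn ℝ Set.univ (norm21 : FMat ι κ → ℝ) := by
  rw [funext (norm21_eq (ι := ι) (κ := κ))]
  exact convexOn_finset_sum _ fun i => convexOn_norm_comp _

theorem convexOn_normRho (ρ : ℕ) : ConvexOn ℝ Set.univ (normRho ρ : FMat ι κ → ℝ) := by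
  unfold normRho
  split_ifs
  exacts [convexOn_norm11, convexOn_norm21]

theorem continuous_normRho (ρ : ℕ) : Continuous (normRho ρ : FMat ι κ → ℝ) := by
  unfold normRho norm11 norm21
  split_ifs <;> fun_prop

end Matrices

section Unmixing

variable {L m nr nc : ℕ} (ρ : ℕ) {lam lamTV : ℝ} (A : Matrix (Fin L) (Fin m) ℝ)
  (Y : FMat (Fin L) (Pixel nr nc))

theorem isClosedProperConvex_unmixing_f (hlam : 0 ≤ lam) :
    IsClosedProperConvex (unmixing ρ lam lamTV A Y).f := by
  have h5 := (blkD5 L m nr nc).continuous_of_finiteDimensional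
  refine isClosedProperConvex_add_indicatorFun
    (C := {M | ∀ p, 0 ≤ blkD5 L m nr nc M p}) ?_ ?_ ?_ ?_ ⟨0, fun p => by simp⟩
  · have h1 := (blkD1 L m nr nc).continuous_of_finiteDimensional
    have h2 := (continuous_normRho ρ).comp (blkD2 L m nr nc).continuous_of_finiteDimensional
    exact (((h1.sub continuous_const).norm.pow 2).const_mul _).add (h2.const_mul lam)
  · refine ConvexOn.add ?_ (((convexOn_normRho ρ).comp_linearMap _).smul hlam)
    have h : ConvexOn ℝ Set.univ fun Z : FMat (Fin L) (Pixel nr nc) => ‖Z - Y‖ :=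
      convexOn_univ_norm.translate_left (-Y) |>.congr fun Z _ => by simp [sub_eq_add_neg]
    exact ((h.pow (fun _ _ => norm_nonneg _) 2).smul (by norm_num : (0:ℝ) ≤ 1 / 2)).comp_linearMap
      (blkD1 L m nr nc)
  · simp only [Set.ofPred_forall]
    exact isClosed_iInter fun p => isClosed_le continuous_const (by fun_prop)
  · intro M hM M' hM' a b ha hb _ p
    have := add_nonneg (mul_nonneg ha (hM p)) (mul_nonneg hb (hM' p))
    simpa using this

theorem isClosedProperConvex_unmixing_g (hlamTV : 0 ≤ lamTV) :
    IsClosedProperConvex (unmixing ρ lam lamTV A Y).g := by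
  have h4 := (blkD4 m nr nc).continuous_of_finiteDimensional
  have h := isClosedProperConvex_add_indicatorFun (C := Set.univ)
    (h := fun N => lamTV * norm11 (blkD4 m nr nc N))
    (((continuous_normRho 1).comp h4).const_mul lamTV)
    ((convexOn_norm11.comp_linearMap (blkD4 m nr nc)).smul hlamTV) isClosed_univ convex_univ
    Set.univ_nonempty
  simp only [indicatorFun, Set.mem_univ, if_true, add_zero] at h
  exact h

theorem injective_unmixing_F : Function.Injective (unmixing ρ lam lamTV A Y).F := by
  refine (injective_iff_map_eq_zero _).2 fun M hM => ?_
  have hM := neg_eq_zero.1 hM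
  ext ⟨i | i | i | i, j⟩
  · exact congrArg (fun Z => Z (Sum.inl i, j)) hM
  · exact congrArg (fun Z => Z (Sum.inr (Sum.inl i), j)) hM
  · exact congrArg (fun Z => Z (Sum.inr (Sum.inr (Sum.inl i)), j)) hM
  · exact congrArg (fun Z => Z (Sum.inr (Sum.inr (Sum.inr (Sum.inr i))), j)) hM

theorem injective_unmixing_G : Function.Injective (unmixing ρ lam lamTV A Y).G := by
  refine (injective_iff_map_eq_zero _).2 fun N hN => ?_
  ext ⟨i | i, j⟩
  · exact congrArg (fun Z => Z (Sum.inr (Sum.inl i), j)) hN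
  · exact congrArg (fun Z => Z (Sum.inr (Sum.inr (Sum.inr (Sum.inl i))), j)) hN

end Unmixing

theorem theorem1 (L m nr nc : ℕ) (ρ : ℕ) (hρ : ρ = 1 ∨ ρ = 2)
    (lam lamTV : ℝ) (hlam : 0 ≤ lam) (hlamTV : 0 ≤ lamTV)
    (A : Matrix (Fin L) (Fin m) ℝ) (Y : FMat (Fin L) (Pixel nr nc))
    (σ τ : ℝ) (hσ : 0 < σ) (hτ0 : 0 < τ) (hτ : τ < (1 + √5) / 2)
    (Sf : SpaceM L m nr nc →ₗ[ℝ] SpaceM L m nr nc)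
    (Sg : SpaceN m nr nc →ₗ[ℝ] SpaceN m nr nc)
    (hSf : IsConvexityOperator (unmixing ρ lam lamTV A Y).f Sf)
    (hSg : IsConvexityOperator (unmixing ρ lam lamTV A Y).g Sg)
    (hΩ : (unmixing ρ lam lamTV A Y).kktSet.Nonempty)
    (M : ℕ → SpaceM L m nr nc) (N : ℕ → SpaceN m nr nc) (Λ : ℕ → SpaceL L m nr nc)
    (hseq : (unmixing ρ lam lamTV A Y).IsADMMSeq σ τ M N Λ) :
    ∃ ubar ∈ (unmixing ρ lam lamTV A Y).kktSet,
      Tendsto (fun k => triple (M k) (N k) (Λ k)) atTop (𝓝 ubar) ∧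
      ∀ η > 0, (unmixing ρ lam lamTV A Y).CalmAtOrigin η ubar →
        ∃ kbar ≥ 1, ∃ μ ∈ Set.Ioo (0 : ℝ) 1,
          (∀ k ≥ kbar,
            weightedDist ((unmixing ρ lam lamTV A Y).opM σ τ Sf Sg)
                (triple (M (k + 1)) (N (k + 1)) (Λ (k + 1)))
                (unmixing ρ lam lamTV A Y).kktSet ^ 2 ≤
              μ * weightedDist ((unmixing ρ lam lamTV A Y).opM σ τ Sf Sg)
                (triple (M k) (N k) (Λ k)) (unmixing ρ lam lamTV A Y).kktSet ^ 2) ∧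
          ∃ ς ∈ Set.Ico μ 1, ∀ k ≥ 1,
            weightedDist ((unmixing ρ lam lamTV A Y).opM σ τ Sf Sg)
                (triple (M (k + 1)) (N (k + 1)) (Λ (k + 1)))
                (unmixing ρ lam lamTV A Y).kktSet ^ 2 ≤
              ς * weightedDist ((unmixing ρ lam lamTV A Y).opM σ τ Sf Sg)
                (triple (M k) (N k) (Λ k)) (unmixing ρ lam lamTV A Y).kktSet ^ 2 := by
  have hf := isClosedProperConvex_unmixing_f ρ (lamTV := lamTV) A Y hlam
  have hg := isClosedProperConvex_unmixing_g ρ (lam := lam) A Y hlamTV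
  have hg' : ∀ N, (unmixing ρ lam lamTV A Y).g N ≠ ⊤ := fun _ => EReal.coe_ne_top _
  obtain ⟨ubar, hubar, hlim⟩ := hseq.exists_tendsto hσ hτ0 hτ hf hg hg' hSf hSg
    (injective_unmixing_F ρ A Y) (injective_unmixing_G ρ A Y) hΩ
  exact ⟨ubar, hubar, hlim, fun η _ hcalm =>
    hseq.exists_linear_rate hσ hτ0 hτ hf hg hg' hSf hSg hubar hlim hcalm⟩
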